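/- Let $F_n$ be the free group of rank $n$. A marked metric graph $A$ of rank $n$ is a finite metric graph without vertices of valence one (vertices of valence two are allowed), with fundamental group identified with $F_n$ by the marking; equivalently, its universal cover $T_A$ is a simplicial metric tree with a free, isometric, cocompact action of $F_n$. Put $l_A(w)=\inf_{p\in T_A}d_{T_A}(p,wp)$ for $w\in F_n$, and $$\Lambda_R(A,B)=\sup_{1\ne w\in F_n}\frac{l_B(w)}{l_A(w)},\qquad \Lambda_L(A,B)=\Lambda_R(B,A),\qquad d(A,B)=\log\bigl(\Lambda_R(A,B)\,\Lambda_L(A,B)\bigr).$$ The distance $d$ does not change if the graphs are rescaled, so it is defined on Outer Space, i.e. on marked metric graphs up to homothety. A PL-map $f:A\to B$ is a map compatible with the markings (it lifts to an $F_n$-equivariant map $T_A\to T_B$) that is linear on each edge $e$, with constant speed $S_{f,e}$. Let $S_f=\max_e S_{f,e}$, and let $A_{max}(f)$ be the subgraph of the edges with $S_{f,e}=S_f$. The map $f$ is optimal if there is no vertex $v$ of $A_{max}(f)$ such that the images of all the edges of $A_{max}(f)$ at $v$ share a common non-trivial initial segment at $f(v)$. A path from $A$ to $B$ built by shrinking and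 folding along an optimal map $f:A\to B$ consists of two parts. (Shrinking.) The lengths of the edges of $A$ are decreased, continuously and monotonically, until the length of each edge $e$ is $l_A(e)\,S_{f,e}/S_f$ (edges of length $0$ are collapsed). Let $A_0$ be the resulting graph, rescaled by the factor $S_f$, so that $f$ induces a map $A_0\to B$, again denoted by $f$, which is an isometry on edges. (Folding.) Put $t_0=0$. Given $A_{t_i}$ and the induced map $f:A_{t_i}\to B$, subdivide both graphs so that $f$ is simplicial. For $r\ge 0$, let $\sim_r$ be the equivalence relation generated on the universal cover of $A_{t_i}$ by $x\sim y$ whenever $f(x)=f(y)$ (for the lift of $f$) and there is a vertex $v$ at distance at most $r$ from both $x$ and $y$. For $t_i\le t\le t_{i+1}$, the graph $A_t$ is the marked metric graph whose universal cover is the metric quotient of that of $A_{t_i}$ by $\sim_{t-t_i}$, where $t_{i+1}$ is the smallest time at which two different edges are completely identified. The process ends, after finitely many steps, when the induced map $A_t\to B$ is an isometry. Let $A,B$ be marked metric graphs of rank $n$, and let $\alpha$ be a path in Outer Space from $A$ to $B$ built by shrinking and folding along an optimal map, parametrised on an interval $[a,b]$ in any monotone way (for example as a $d_R$-geodesic,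 i.e. by the distance $d_R(A,\cdot)$ from $A$, where $d_R=\log\Lambda_R$ on representatives of volume one). Then for all $a\le s\le x\le y\le t\le b$, $$d(\alpha(s),\alpha(t))\ \ge\ d(\alpha(x),\alpha(y)).$$ -/

import Mathlib

universe u

namespace OuterSpace

open Set

/-! A point of unprojectivised Outer Space of rank `n` is described by its universal cover: a free,
isometric, cocompact action of the free group of rank `n` on a simplicial metric tree.  Since
shrinking may collapse edges and folding identifies points, (pseudo-)distances are treated as
functions `D : T → T → ℝ`; points with `D x y = 0` represent the same point. -/

/-- `z` lies on the segment from `x` to `y`. -/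
def Between {T : Type*} (D : T → T → ℝ) (x z y : T) : Prop :=
  D x z + D z y = D x y

/-- `(a, b)` is an (oriented) edge with respect to the vertex set `V`: two different vertices
such that the segment between them contains no further vertex. -/
def IsEdge {T : Type*} (D : T → T → ℝ) (V : Set T) (a b : T) : Prop :=
  a ∈ V ∧ b ∈ V ∧ D a b ≠ 0 ∧ ∀ z ∈ V, Between D a z b → D a z = 0 ∨ D z b = 0

/-- `D` is a pseudo-distance on `T` invariant under the action of `G`. -/
structure IsInvariantPseudoDist (G : Type*) [Group G] {T : Type*} [MulAction G T]
    (D : T → T → ℝ) : Prop where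
  self : ∀ x, D x x = 0
  nonneg : ∀ x y, 0 ≤ D x y
  symm : ∀ x y, D x y = D y x
  triangle : ∀ x y z, D x z ≤ D x y + D y z
  smul : ∀ (g : G) x y, D (g • x) (g • y) = D x y

/-- `(T, D)` is a simplicial `ℝ`-tree with vertex set `V`, on which `G` acts freely, simplicially,
isometrically, and with finitely many orbits of edges.  An `ℝ`-tree is a geodesic space satisfying
the four point inequality of `0`-hyperbolicity. -/
structure IsSimplicialTree (G : Type*) [Group G] {T : Type*} [MulAction G T]
    (D : T → T → ℝ) (V : Set T) : Prop extends IsInvariantPseudoDist G D where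
  geodesic : ∀ x y, ∀ r ∈ Icc 0 (D x y), ∃ z, D x z = r ∧ D z y = D x y - r
  hyperbolic : ∀ x y z w, D x y + D z w ≤ max (D x z + D y w) (D x w + D y z)
  vertex_nonempty : V.Nonempty
  vertex_smul : ∀ (g : G), ∀ v ∈ V, g • v ∈ V
  vertex_discrete : ∃ ε > 0, ∀ v ∈ V, ∀ w ∈ V, D v w = 0 ∨ ε ≤ D v w
  /-- The tree is the union of its edges. -/
  edge_cover : ∀ x, ∃ a b, IsEdge D V a b ∧ Between D a x b
  /-- A point which is not a vertex lies on only one edge. -/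
  edge_unique : ∀ x, x ∉ V → ∀ a b a' b', IsEdge D V a b → IsEdge D V a' b' →
    Between D a x b → Between D a' x b' →
    (D a a' = 0 ∧ D b b' = 0) ∨ (D a b' = 0 ∧ D b a' = 0)
  free : ∀ (g : G) x, D x (g • x) = 0 → g = 1
  edge_finite : ∃ F : Set (T × T), F.Finite ∧ ∀ a b, IsEdge D V a b →
    ∃ g : G, ∃ e ∈ F, D (g • a) e.1 = 0 ∧ D (g • b) e.2 = 0

/-- A marked metric graph of rank `n` (a point of unprojectivised Outer Space), given by the free
action of `F_n` on its universal cover `T`.  Vertices of valence two are allowed. -/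
structure MarkedMetricGraph (n : ℕ) where
  T : Type u
  [metric : MetricSpace T]
  [action : MulAction (FreeGroup (Fin n)) T]
  V : Set T
  simplicial : IsSimplicialTree (FreeGroup (Fin n)) (fun x y : T => dist x y) V
  valence : ∀ v ∈ V, ∃ a b, a ≠ b ∧ IsEdge (fun x y : T => dist x y) V v a ∧
    IsEdge (fun x y : T => dist x y) V v b

attribute [instance] MarkedMetricGraph.metric MarkedMetricGraph.action

variable {n : ℕ}

/-- Oriented edges of (the universal cover of) a marked metric graph. -/
def MarkedMetricGraph.Edge (A : MarkedMetricGraph.{u} n) (a b : A.T) : Prop :=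
  IsEdge (fun x y : A.T => dist x y) A.V a b

/-- The translation length `l_A(w)`. -/
noncomputable def MarkedMetricGraph.len (A : MarkedMetricGraph.{u} n)
    (w : FreeGroup (Fin n)) : ℝ :=
  ⨅ p : A.T, dist p (w • p)

/-- The right hand factor `Λ_R(A, B) = sup_{w ≠ 1} l_B(w) / l_A(w)`. -/
noncomputable def stretchR (A B : MarkedMetricGraph.{u} n) : ENNReal :=
  ⨆ (w : FreeGroup (Fin n)) (_ : w ≠ 1), ENNReal.ofReal (B.len w / A.len w)

/-- The left hand factor `Λ_L(A, B) = sup_{w ≠ 1} l_A(w) / l_B(w)`. -/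
noncomputable def stretchL (A B : MarkedMetricGraph.{u} n) : ENNReal :=
  ⨆ (w : FreeGroup (Fin n)) (_ : w ≠ 1), ENNReal.ofReal (A.len w / B.len w)

/-- The symmetric distance `d(A, B) = log (Λ_R(A, B) Λ_L(A, B))`, a priori in `[-∞, ∞]`. -/
noncomputable def symDist (A B : MarkedMetricGraph.{u} n) : EReal :=
  ENNReal.log (stretchR A B * stretchL A B)

section Maps

variable {A B : MarkedMetricGraph.{u} n}

/-- The speed of `f` on the edge from `a` to `b`. -/
noncomputable def speed (f : A.T → B.T) (a b : A.T) : ℝ :=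
  dist (f a) (f b) / dist a b

/-- The maximal speed `S_f`. -/
noncomputable def maxSpeed (f : A.T → B.T) : ℝ :=
  sSup {r | ∃ a b, A.Edge a b ∧ r = speed f a b}

/-- `f` is (the lift of) a PL-map compatible with the markings: it is equivariant and linear
on edges. -/
def IsPL (f : A.T → B.T) : Prop :=
  (∀ (g : FreeGroup (Fin n)) x, f (g • x) = g • f x) ∧
  ∀ a b, A.Edge a b → ∀ x y, Between (fun p q : A.T => dist p q) a x b →
    Between (fun p q : A.T => dist p q) a y b → dist (f x) (f y) = speed f a b * dist x y

/-- Edges of `A_max(f)`, the subgraph of the maximally stretched edges. -/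
def IsMaxEdge (f : A.T → B.T) (a b : A.T) : Prop :=
  A.Edge a b ∧ speed f a b = maxSpeed f

/-- A PL-map is optimal unless there is a vertex `v` of `A_max(f)` such that the images of all
the edges of `A_max(f)` at `v` have a common non-trivial segment `[f v, y]` at `f v`. -/
def IsOptimal (f : A.T → B.T) : Prop :=
  IsPL f ∧ ¬ ∃ v, (∃ a, IsMaxEdge f v a) ∧ ∃ y, y ≠ f v ∧
    ∀ a, IsMaxEdge f v a → Between (fun p q : B.T => dist p q) (f v) y (f a)

/-- `D` is obtained from the distance of `A` by changing the lengths of the edges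
(the edge from `a` to `b` gets length `D a b`, possibly `0`, in which case it is collapsed). -/
structure IsEdgeRescaling (A : MarkedMetricGraph.{u} n) (D : A.T → A.T → ℝ) : Prop extends
    IsInvariantPseudoDist (FreeGroup (Fin n)) D where
  linear : ∀ a b, A.Edge a b → ∀ x y, Between (fun p q : A.T => dist p q) a x b →
    Between (fun p q : A.T => dist p q) a y b → D x y = D a b / dist a b * dist x y
  additive : ∀ x z y, Between (fun p q : A.T => dist p q) x z y → Between D x z y

/-- The shrinking from `A` to `A'`, parametrised by `[0, 1]`: the lengths of the edges change
continuously and never increase, and at the end each edge is stretched by `f` exactly by the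
factor `S_f`. -/
structure IsShrinking (f : A.T → B.T) (D : ℝ → A.T → A.T → ℝ) : Prop where
  rescaling : ∀ p ∈ Icc (0 : ℝ) 1, IsEdgeRescaling A (D p)
  start : ∀ x y, D 0 x y = dist x y
  antitone : ∀ a b, A.Edge a b → AntitoneOn (fun p => D p a b) (Icc 0 1)
  continuous : ∀ a b, A.Edge a b → ContinuousOn (fun p => D p a b) (Icc 0 1)
  finish : ∀ a b, A.Edge a b → dist (f a) (f b) = maxSpeed f * D 1 a b

end Maps

section Folding

variable {T S : Type*}

/-- The union over all vertices `v ∈ U` of the relations `x ∼_{t,v} y`: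
`f x = f y`, and both `x` and `y` are at distance at most `t` from `v`. -/
def FoldRel (f : T → S) (D : T → T → ℝ) (U : Set T) (t : ℝ) (x y : T) : Prop :=
  ∃ v ∈ U, f x = f y ∧ D x v ≤ t ∧ D y v ≤ t

/-- `Chain D R x y r`: there is a chain of total length `r` from `x` to `y` made of displacements
in `(T, D)`, between which one may jump from a point to a point related to it by `R`. -/
inductive Chain (D : T → T → ℝ) (R : T → T → Prop) : T → T → ℝ → Prop
  | move (x y : T) : Chain D R x y (D x y)
  | jump {x y z : T} {r : ℝ} (w : T) : Chain D R x y r → R y z → Chain D R x w (r + D z w)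

/-- The distance of the quotient of `(T, D)` by the equivalence relation generated by the symmetric
relation `R` (as a pseudo-distance on `T`): the infimum of the lengths of chains. -/
noncomputable def quotDist (D : T → T → ℝ) (R : T → T → Prop) (x y : T) : ℝ :=
  sInf {r | Chain D R x y r}

/-- The distance after folding `(T, D)` at all its vertices for the time `t`. -/
noncomputable def foldDist (f : T → S) (D : T → T → ℝ) (U : Set T) (t : ℝ) : T → T → ℝ :=
  quotDist D (FoldRel f D U t)

/-- Two different edges of `(T, D)` are completely identified after folding for the time `t`. -/
def IdentifiesEdges (f : T → S) (D : T → T → ℝ) (U : Set T) (t : ℝ) : Prop :=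
  ∃ a b a' b', IsEdge D U a b ∧ IsEdge D U a' b' ∧ ¬ (D a a' = 0 ∧ D b b' = 0) ∧
    foldDist f D U t a a' = 0 ∧ foldDist f D U t b b' = 0

end Folding

/-- A path from `A` to `B` built by shrinking and fast folding along an optimal map `f`.
All graphs on the path are given by pseudo-distances on the universal cover of `A`. -/
structure ShrinkFoldPath (A B : MarkedMetricGraph.{u} n) where
  f : A.T → B.T
  optimal : IsOptimal f
  /-- The shrinking part. -/
  D : ℝ → A.T → A.T → ℝ
  shrinking : IsShrinking f D
  /-- The folding part: `E t`, for `0 ≤ t ≤ τ N`, is the distance of `A_t`. -/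
  E : ℝ → A.T → A.T → ℝ
  /-- The number of steps of the folding part. -/
  N : ℕ
  /-- The times `0 = t_0 < t_1 < ... < t_N` separating the steps. -/
  τ : ℕ → ℝ
  τ_zero : τ 0 = 0
  /-- `A_0` is homothetic to `A'`, scaled so that `f` is an isometry on edges. -/
  E_zero : ∀ x y, E 0 x y = maxSpeed f * D 1 x y
  /-- The vertices of `A_{t_i}`, after a subdivision. -/
  U : ℕ → Set A.T
  /-- The vertices of `B`, after a subdivision. -/
  W : ℕ → Set B.T
  subdivision_zero : A.V ⊆ U 0
  subdivision_source : ∀ i < N, IsSimplicialTree (FreeGroup (Fin n)) (E (τ i)) (U i)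
  subdivision_target : ∀ i < N, B.V ⊆ W i ∧
    IsSimplicialTree (FreeGroup (Fin n)) (fun x y : B.T => dist x y) (W i)
  /-- With these subdivisions `f` is simplicial, and isometric on edges. -/
  vertex_to_vertex : ∀ i < N, MapsTo f (U i) (W i)
  edge_to_edge : ∀ i < N, ∀ a b, IsEdge (E (τ i)) (U i) a b →
    IsEdge (fun x y : B.T => dist x y) (W i) (f a) (f b) ∧
    ∀ x y, Between (E (τ i)) a x b → Between (E (τ i)) a y b → dist (f x) (f y) = E (τ i) x y
  /-- The step lasts until, for the first time, a pair of edges is completely identified. -/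
  step : ∀ i < N, IsLeast {t | 0 ≤ t ∧ IdentifiesEdges f (E (τ i)) (U i) t} (τ (i + 1) - τ i)
  folding : ∀ i < N, ∀ t ∈ Icc (τ i) (τ (i + 1)), E t = foldDist f (E (τ i)) (U i) (t - τ i)
  /-- The process ends when the map induced by `f` is an isometry to `B`. -/
  finish : ∀ x y, E (τ N) x y = dist (f x) (f y)

/-- The distance at the time `p`, where `-1 ≤ p < 0` is the shrinking part and
`0 ≤ p ≤ τ N` the folding part. -/
noncomputable def ShrinkFoldPath.distAt {A B : MarkedMetricGraph.{u} n} (P : ShrinkFoldPath A B)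
    (p : ℝ) : A.T → A.T → ℝ :=
  open Classical in if p < 0 then P.D (p + 1) else P.E p

/-- The marked metric graph `X` represents, up to scaling, the marked metric graph whose universal
cover is `(T, D)`: the tree of `X` is equivariantly homothetic to an invariant subtree of `(T, D)`
(there is only one minimal such subtree; it is everything unless folding has created
vertices of valence one). -/
def Represents (X : MarkedMetricGraph.{u} n) {T : Type u} [MulAction (FreeGroup (Fin n)) T]
    (D : T → T → ℝ) : Prop :=
  ∃ c : ℝ, 0 < c ∧ ∃ h : X.T → T, (∀ x y, D (h x) (h y) = c * dist x y) ∧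
    ∀ (g : FreeGroup (Fin n)) x, D (h (g • x)) (g • h x) = 0

/-- `α`, defined on `[a, b]`, is a path in Outer Space from `A` to `B` built by shrinking and
folding, with an arbitrary monotone parametrisation (for instance the one by the distance
`d_R` from `A`). -/
def IsShrinkFoldGeodesic (A B : MarkedMetricGraph.{u} n) (α : ℝ → MarkedMetricGraph.{u} n)
    (a b : ℝ) : Prop :=
  ∃ (P : ShrinkFoldPath A B) (φ : ℝ → ℝ), MonotoneOn φ (Icc (-1) (P.τ P.N)) ∧
    φ '' Icc (-1) (P.τ P.N) = Icc a b ∧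
    ∀ p ∈ Icc (-1) (P.τ P.N), Represents (α (φ p)) (P.distAt p)

end OuterSpace

namespace OuterSpace

open Set

/-! ### Countable closed partitions of an interval -/

section Partition

variable {ι : Type*} {I : ι → Set ℝ} {p q : ℝ}

/-! All graphs on the path are pseudo-distances on one set, the universal cover of `A`. Scale them
so that the path starts with `maxSpeed f` times the distance of `A` and ends with the distance of
`B` pulled back by `f`. Then shrinking and folding both decrease the distance of every pair of
points (`scaledDist_antitoneOn`), so for every `g` the scaled translation length `c p * l_p(g)`
decreases along the path.

One element keeps its scaled length. Since `f` is optimal, every maximally stretched edge continues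
legally, and by finiteness a legal path closes up to a loop `g` with `S_f * l_A(g) ≤ l_B(g)`
(`IsOptimal.exists_maxSpeed_mul_len_le`); its scaled length is squeezed between the two ends. Hence
the right hand factor between two points of the path is exactly the ratio of their scales, and the
product of both factors is the supremum over `g` of earlier scaled length over later scaled length
(`stretchR_mul_stretchL`). Widening the interval raises each numerator and lowers each denominator.

Translation lengths are compared as growth rates of `D q (g ^ k • q)`: these do not depend on the
base point, and so can be computed in the subtree that represents a graph as well as in the whole
pseudo-metric space. -/

theorem exists_subset_of_subset_iUnion_interior
    (hdisj : ∀ x ∈ Ioo p q, ∀ i j, x ∈ I i → x ∈ I j → I i = I j)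
    {C : Set ℝ} (hC : IsPreconnected C) (hne : C.Nonempty) (hCpq : C ⊆ Ioo p q)
    (hCI : C ⊆ ⋃ i, interior (I i)) : ∃ i, C ⊆ I i := by
  obtain ⟨x, hx⟩ := hne
  obtain ⟨i, hi⟩ := mem_iUnion.1 (hCI hx)
  refine ⟨i, ?_⟩
  have key := hC.subset_left_of_subset_union (u := interior (I i) ∩ Ioo p q)
    (v := (⋃ (j) (_ : I j ≠ I i), interior (I j)) ∩ Ioo p q)
    (isOpen_interior.inter isOpen_Ioo)
    ((isOpen_iUnion fun j => isOpen_iUnion fun _ => isOpen_interior).inter isOpen_Ioo)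
    ?_ ?_ ⟨x, hx, hi, hCpq hx⟩
  · exact fun y hy => interior_subset (key hy).1
  · rw [Set.disjoint_left]
    rintro y ⟨hy, hypq⟩ ⟨hy', -⟩
    simp only [mem_iUnion] at hy'
    obtain ⟨j, hj, hyj⟩ := hy'
    exact hj (hdisj y hypq j i (interior_subset hyj) (interior_subset hy))
  · intro y hy
    obtain ⟨j, hj⟩ := mem_iUnion.1 (hCI hy)
    by_cases h : I j = I i
    · exact Or.inl ⟨h ▸ hj, hCpq hy⟩
    · exact Or.inr ⟨mem_iUnion₂.2 ⟨j, h, hj⟩, hCpq hy⟩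

/-- An open interval is not the disjoint union of countably many (at least two) closed sets. -/
theorem exists_Ioo_subset_of_countable_closed_partition [Countable ι]
    (hcl : ∀ i, IsClosed (I i)) (hpq : p < q) (hcov : Ioo p q ⊆ ⋃ i, I i)
    (hdisj : ∀ x ∈ Ioo p q, ∀ i j, x ∈ I i → x ∈ I j → I i = I j) :
    ∃ i, Ioo p q ⊆ I i := by
  set G : Set ℝ := ⋃ i, interior (I i) with hG
  have hGo : IsOpen G := isOpen_iUnion fun _ => isOpen_interior
  by_cases hK : (Ioo p q \ G).Nonempty
  swap
  · rw [not_nonempty_iff_eq_empty, sdiff_eq_empty] at hK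
    exact exists_subset_of_subset_iUnion_interior hdisj isPreconnected_Ioo (nonempty_Ioo.2 hpq)
      subset_rfl hK
  exfalso
  set K : Set ℝ := Ioo p q \ G with hKdef
  have : LocallyCompactSpace K :=
    (isOpen_Ioo.isLocallyClosed.inter hGo.isClosed_compl.isLocallyClosed).locallyCompactSpace
  have : Nonempty K := hK.to_subtype
  -- Baire category on `K`, the points interior to no piece: some `I i` contains a relative
  -- neighbourhood in `K` of a point `r`. It will follow that `I i` contains a genuine neighbourhood
  -- of `r`, contradicting `r ∉ G`.
  obtain ⟨i, ⟨r, hrK⟩, hr⟩ := nonempty_interior_of_iUnion_of_closed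
    (f := fun i => (Subtype.val ⁻¹' (I i) : Set K))
    (fun i => (hcl i).preimage continuous_subtype_val)
    (eq_univ_of_forall fun x => by
      obtain ⟨i, hi⟩ := mem_iUnion.1 (hcov x.2.1)
      exact mem_iUnion.2 ⟨i, hi⟩)
  obtain ⟨hrpq, hrG⟩ := id hrK
  have hri : r ∈ I i := by
    have := interior_subset hr
    exact this
  rw [mem_interior_iff_mem_nhds, nhds_subtype_eq_comap, Filter.mem_comap] at hr
  obtain ⟨t, ht, hti⟩ := hr
  obtain ⟨a, b, ⟨har, hrb⟩, hab⟩ := mem_nhds_iff_exists_Ioo_subset.1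
    (Filter.inter_mem ht (Ioo_mem_nhds hrpq.1 hrpq.2))
  have hnot : ∀ s ∈ Ioo a b, s ∉ I i → s ∈ G := by
    intro s hs hsi
    by_contra hsG
    exact hsi (hti (show (⟨s, (hab hs).2, hsG⟩ : K) ∈ _ from (hab hs).1))
  have hsub : Ioo a b ⊆ I i := by
    intro s hs
    by_contra hsi
    rcases lt_trichotomy s r with hsr | rfl | hsr
    -- Let `c` be the first point of `I i` after `s`. The interval from `s` up to `c` lies in a
    -- single piece, which is closed and so contains `c`; by disjointness this piece is `I i`,
    -- although `s` is outside it.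
    · have hne : (I i ∩ Icc s r).Nonempty := ⟨r, hri, hsr.le, le_rfl⟩
      have hbdd : BddBelow (I i ∩ Icc s r) := ⟨s, fun x hx => hx.2.1⟩
      obtain ⟨hci, hcs⟩ := ((hcl i).inter isClosed_Icc).csInf_mem hne hbdd
      set c := sInf (I i ∩ Icc s r)
      have hsc : s < c := lt_of_le_of_ne hcs.1 (fun h => hsi (h ▸ hci))
      have hout : ∀ x ∈ Ico s c, x ∉ I i := fun x hx hxi =>
        absurd (csInf_le hbdd ⟨hxi, hx.1, hx.2.le.trans hcs.2⟩) (not_le.2 hx.2)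
      have hIab : Ico s c ⊆ Ioo a b := fun x hx =>
        ⟨hs.1.trans_le hx.1, (hx.2.trans_le hcs.2).trans hrb⟩
      obtain ⟨j, hj⟩ := exists_subset_of_subset_iUnion_interior hdisj isPreconnected_Ico
        (nonempty_Ico.2 hsc) (fun x hx => (hab (hIab hx)).2)
        (fun x hx => hnot x (hIab hx) (hout x hx))
      have hcj : c ∈ I j := (hcl j).closure_subset_iff.2 hj
        (by rw [closure_Ico hsc.ne]; exact right_mem_Icc.2 hsc.le)
      have hcab : c ∈ Ioo a b := ⟨hs.1.trans hsc, hcs.2.trans_lt hrb⟩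
      exact hsi (hdisj c (hab hcab).2 i j hci hcj ▸ hj (left_mem_Ico.2 hsc))
    · exact hsi hri
    · have hne : (I i ∩ Icc r s).Nonempty := ⟨r, hri, le_rfl, hsr.le⟩
      have hbdd : BddAbove (I i ∩ Icc r s) := ⟨s, fun x hx => hx.2.2⟩
      obtain ⟨hci, hcs⟩ := ((hcl i).inter isClosed_Icc).csSup_mem hne hbdd
      set c := sSup (I i ∩ Icc r s)
      have hsc : c < s := lt_of_le_of_ne hcs.2 (fun h => hsi (h ▸ hci))
      have hout : ∀ x ∈ Ioc c s, x ∉ I i := fun x hx hxi =>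
        absurd (le_csSup hbdd ⟨hxi, hcs.1.trans hx.1.le, hx.2⟩) (not_le.2 hx.1)
      have hIab : Ioc c s ⊆ Ioo a b := fun x hx =>
        ⟨har.trans (hcs.1.trans_lt hx.1), hx.2.trans_lt hs.2⟩
      obtain ⟨j, hj⟩ := exists_subset_of_subset_iUnion_interior hdisj isPreconnected_Ioc
        (nonempty_Ioc.2 hsc) (fun x hx => (hab (hIab hx)).2)
        (fun x hx => hnot x (hIab hx) (hout x hx))
      have hcj : c ∈ I j := (hcl j).closure_subset_iff.2 hj
        (by rw [closure_Ioc hsc.ne]; exact left_mem_Icc.2 hsc.le)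
      have hcab : c ∈ Ioo a b := ⟨har.trans_le hcs.1, hsc.trans hs.2⟩
      exact hsi (hdisj c (hab hcab).2 i j hci hcj ▸ hj (right_mem_Ioc.2 hsc))
  exact hrG (mem_iUnion.2 ⟨i, interior_mono hsub (by
    rw [interior_Ioo]; exact ⟨har, hrb⟩)⟩)

end Partition

/-! ### Segments in trees -/

section Tree

variable {T : Type*} [MetricSpace T]

/-- In a `0`-hyperbolic space, a path is geodesic if it is so locally. -/
theorem dist_eq_add_of_overlap
    (hyp : ∀ x y z w : T, dist x y + dist z w ≤ max (dist x z + dist y w) (dist x w + dist y z))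
    {a b c d : T} (habc : dist a b + dist b c = dist a c) (hbcd : dist b c + dist c d = dist b d)
    (hbc : b ≠ c) : dist a c + dist c d = dist a d := by
  -- The first alternative of the maximum would give `2 * dist b c ≤ 0`; the second is the claim.
  have h := hyp a c b d
  have h0 := dist_pos.2 hbc
  have h1 := dist_triangle a c d
  rw [dist_comm c b] at h
  rcases le_max_iff.1 h with h | h <;> linarith

theorem dist_eq_sum_of_local
    (hyp : ∀ x y z w : T, dist x y + dist z w ≤ max (dist x z + dist y w) (dist x w + dist y z))
    {x : ℕ → T} (hne : ∀ k, x k ≠ x (k + 1))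
    (hloc : ∀ k, dist (x k) (x (k + 1)) + dist (x (k + 1)) (x (k + 2)) = dist (x k) (x (k + 2)))
    {i j : ℕ} (hij : i ≤ j) :
    dist (x i) (x j) = ∑ k ∈ Finset.Ico i j, dist (x k) (x (k + 1)) := by
  have key : ∀ j, i ≤ j →
      dist (x i) (x j) + dist (x j) (x (j + 1)) = dist (x i) (x (j + 1)) := by
    intro j hij
    induction j, hij using Nat.le_induction with
    | base => simp
    | succ j _ ih => exact dist_eq_add_of_overlap hyp ih (hloc j) (hne j)
  induction j, hij using Nat.le_induction with
  | base => simp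
  | succ j hj ih => rw [Finset.sum_Ico_succ_top hj, ← ih, key j hj]

/-- Points are chosen independently at each distance from `x`; the four point inequality for `x`,
`y` and two chosen points forces these to be at the right distance from each other. -/
theorem exists_isometric_segment
    (hgeo : ∀ x y : T, ∀ r ∈ Icc 0 (dist x y), ∃ z, dist x z = r ∧ dist z y = dist x y - r)
    (hyp : ∀ x y z w : T, dist x y + dist z w ≤ max (dist x z + dist y w) (dist x w + dist y z))
    (x y : T) : ∃ γ : Icc 0 (dist x y) → T, Isometry γ ∧
      ∀ r, dist x (γ r) = r ∧ dist (γ r) y = dist x y - r := by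
  choose γ hγ using fun r : Icc 0 (dist x y) => hgeo x y r r.2
  refine ⟨γ, Isometry.of_dist_eq fun r s => ?_, hγ⟩
  have h1 := hyp x y (γ r) (γ s)
  rw [dist_comm y, dist_comm y, (hγ r).1, (hγ r).2, (hγ s).1, (hγ s).2] at h1
  have h2 := dist_triangle x (γ r) (γ s)
  have h3 := dist_triangle x (γ s) (γ r)
  rw [(hγ r).1, (hγ s).1] at h2 h3
  rw [dist_comm (γ s)] at h3
  rw [Subtype.dist_eq, Real.dist_eq]
  refine le_antisymm ?_ (abs_le.2 ⟨by linarith, by linarith⟩)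
  rcases le_max_iff.1 h1 with h | h
  · linarith [le_abs_self ((r : ℝ) - s)]
  · linarith [neg_abs_le ((r : ℝ) - s)]

end Tree

/-! ### From edges to arbitrary pairs of points. -/

namespace MarkedMetricGraph

variable {n : ℕ} (X : MarkedMetricGraph.{u} n)

theorem Edge.swap {X : MarkedMetricGraph.{u} n} {a b : X.T} (h : X.Edge a b) : X.Edge b a := by
  refine ⟨h.2.1, h.1, by simpa [dist_comm] using h.2.2.1, fun z hz hbz => ?_⟩
  have := h.2.2.2 z hz (by
    simp only [Between] at hbz ⊢
    rw [dist_comm a z, dist_comm z b, dist_comm a b]; linarith)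
  simpa only [dist_comm b z, dist_comm z a] using this.symm

theorem Edge.ne {X : MarkedMetricGraph.{u} n} {a b : X.T} (h : X.Edge a b) : a ≠ b :=
  fun hab => h.2.2.1 (by simp [hab])

theorem dist_smul (g : FreeGroup (Fin n)) (x y : X.T) : dist (g • x) (g • y) = dist x y :=
  X.simplicial.smul g x y

theorem countable_edge : {e : X.T × X.T | X.Edge e.1 e.2}.Countable := by
  obtain ⟨F, hF, h⟩ := X.simplicial.edge_finite
  have : Countable (FreeGroup (Fin n)) := by unfold FreeGroup; infer_instance
  have hc : (⋃ g : FreeGroup (Fin n), (fun e : X.T × X.T => (g • e.1, g • e.2)) '' F).Countable :=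
    countable_iUnion fun g => hF.countable.image _
  refine hc.mono ?_
  rintro ⟨a, b⟩ hab
  obtain ⟨g, e, he, h1, h2⟩ := h a b hab
  refine mem_iUnion.2 ⟨g⁻¹, e, he, ?_⟩
  simp only [dist_eq_zero] at h1 h2
  simp [← h1, ← h2]

/-- The points `x` and `y` lie on a common edge. -/
def OnEdge (x y : X.T) : Prop :=
  ∃ a b, X.Edge a b ∧ Between (fun p q : X.T => dist p q) a x b ∧
    Between (fun p q : X.T => dist p q) a y b

/-- The edges are countably many closed sets covering the segment, and by `edge_unique` two of them
that meet at an interior point of the segment coincide. The partition theorem then puts the whole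
interior, and by closure also `x` and `y`, on one edge. -/
theorem onEdge_of_no_vertex (x y : X.T)
    (h : ∀ z ∈ X.V, Between (fun p q : X.T => dist p q) x z y → z = x ∨ z = y) :
    X.OnEdge x y := by
  rcases eq_or_ne x y with rfl | hxy
  · obtain ⟨a, b, hab, hx⟩ := X.simplicial.edge_cover x
    exact ⟨a, b, hab, hx, hx⟩
  have hL := dist_pos.2 hxy
  obtain ⟨γ, hγ, hγd⟩ := exists_isometric_segment X.simplicial.geodesic X.simplicial.hyperbolic x y
  set γ' : ℝ → X.T := fun r => γ (projIcc 0 (dist x y) hL.le r) with hγ'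
  have hcont : Continuous γ' := hγ.continuous.comp continuous_projIcc
  have h0 : γ' 0 = x := by
    have := (hγd (projIcc 0 (dist x y) hL.le 0)).1
    simp only [projIcc_left] at this
    simpa [γ', eq_comm] using this
  have h1 : γ' (dist x y) = y := by
    have := (hγd (projIcc 0 (dist x y) hL.le (dist x y))).2
    simp only [projIcc_right] at this
    simpa [γ', eq_comm] using this
  have hV : ∀ r ∈ Ioo 0 (dist x y), γ' r ∉ X.V := by
    intro r hr hv
    have hd := hγd ⟨r, hr.1.le, hr.2.le⟩
    have hγr : γ' r = γ ⟨r, hr.1.le, hr.2.le⟩ := by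
      simp only [γ', projIcc_of_mem hL.le ⟨hr.1.le, hr.2.le⟩]
    rw [← hγr] at hd
    simp only at hd
    rcases h _ hv (show dist _ _ + dist _ _ = dist _ _ by rw [hd.1, hd.2]; ring) with h | h
    · rw [h, dist_self] at hd; linarith [hr.1]
    · rw [h, dist_self] at hd; linarith [hr.2]
  have : Countable {e : X.T × X.T | X.Edge e.1 e.2} := X.countable_edge.to_subtype
  obtain ⟨⟨⟨a, b⟩, hab⟩, hsub⟩ := exists_Ioo_subset_of_countable_closed_partition
    (I := fun e : {e : X.T × X.T | X.Edge e.1 e.2} =>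
      {r : ℝ | dist e.1.1 (γ' r) + dist (γ' r) e.1.2 = dist e.1.1 e.1.2})
    (fun e => isClosed_eq ((continuous_const.dist hcont).add (hcont.dist continuous_const))
      continuous_const) hL
    (fun r _ => by
      obtain ⟨a, b, hab, hr⟩ := X.simplicial.edge_cover (γ' r)
      exact mem_iUnion.2 ⟨⟨(a, b), hab⟩, hr⟩)
    (fun r hr e e' he he' => by
      rcases X.simplicial.edge_unique _ (hV r hr) _ _ _ _ e.2 e'.2 he he' with ⟨h1, h2⟩ | ⟨h1, h2⟩
      · rw [dist_eq_zero] at h1 h2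
        rw [h1, h2]
      · rw [dist_eq_zero] at h1 h2
        rw [h1, h2]
        ext s
        simp only [mem_ofPred_eq]
        rw [add_comm, dist_comm e'.1.2, dist_comm e'.1.2, dist_comm (γ' s) e'.1.1])
  have hcl : Icc 0 (dist x y) ⊆ {r : ℝ | dist a (γ' r) + dist (γ' r) b = dist a b} := by
    rw [← closure_Ioo hL.ne]
    exact (IsClosed.closure_subset_iff (isClosed_eq ((continuous_const.dist hcont).add
      (hcont.dist continuous_const)) continuous_const)).2 hsub
  refine ⟨a, b, hab, ?_, ?_⟩
  · have := hcl (left_mem_Icc.2 hL.le)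
    rwa [mem_ofPred_eq, h0] at this
  · have := hcl (right_mem_Icc.2 hL.le)
    rwa [mem_ofPred_eq, h1] at this

/-- A subadditive function is bounded by an additive one if it is so on each edge. -/
theorem le_of_le_on_edges {Φ Ψ : X.T → X.T → ℝ} (hΦ : ∀ x z y, Φ x y ≤ Φ x z + Φ z y)
    (hΨ : ∀ x z y, Between (fun p q : X.T => dist p q) x z y → Between Ψ x z y)
    (h : ∀ x y, X.OnEdge x y → Φ x y ≤ Ψ x y) (x y : X.T) : Φ x y ≤ Ψ x y := by
  have split : ∀ x z y, Between (fun p q : X.T => dist p q) x z y → Φ x z ≤ Ψ x z →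
      Φ z y ≤ Ψ z y → Φ x y ≤ Ψ x y := fun x z y hz h1 h2 =>
    (hΦ x z y).trans ((add_le_add h1 h2).trans_eq (hΨ x z y hz))
  obtain ⟨ε, hε, hdisc⟩ := X.simplicial.vertex_discrete
  -- A segment shorter than `ε` contains at most one vertex, hence splits into at most two pieces,
  -- each on one edge.
  have small : ∀ x y, dist x y < ε → Φ x y ≤ Ψ x y := by
    intro x y hxy
    by_cases hv : ∃ v ∈ X.V, Between (fun p q : X.T => dist p q) x v y
    · obtain ⟨v, hv, hxvy⟩ := hv
      simp only [Between] at hxvy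
      have same : ∀ z ∈ X.V, dist v z < ε → z = v := fun z hz hd => by
        rcases hdisc v hv z hz with h | h
        · exact (dist_eq_zero.1 h).symm
        · exact absurd hd (not_lt.2 h)
      refine split x v y hxvy (h _ _ ?_) (h _ _ ?_)
      · refine X.onEdge_of_no_vertex _ _ fun z hz hb => Or.inr (same z hz ?_)
        simp only [Between] at hb
        rw [dist_comm]
        linarith [dist_nonneg (x := x) (y := z), dist_nonneg (x := v) (y := y)]
      · refine X.onEdge_of_no_vertex _ _ fun z hz hb => Or.inl (same z hz ?_)
        simp only [Between] at hb
        linarith [dist_nonneg (x := x) (y := v), dist_nonneg (x := z) (y := y)]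
    · exact h _ _ (X.onEdge_of_no_vertex _ _ fun z hz hb => absurd ⟨z, hz, hb⟩ hv)
  have all : ∀ k : ℕ, ∀ x y, dist x y < (k + 1) * ε → Φ x y ≤ Ψ x y := by
    intro k
    induction k with
    | zero => intro x y hxy; exact small x y (by simpa using hxy)
    | succ k ih =>
      intro x y hxy
      push_cast at hxy
      rcases lt_or_ge (dist x y) ((k + 1) * ε) with hlt | hge
      · exact ih x y hlt
      · have hk : (0 : ℝ) ≤ k := k.cast_nonneg
        -- This proportion leaves a first piece shorter than `(k + 1) * ε` and a second one shorter
        -- than `ε`.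
        obtain ⟨z, hz1, hz2⟩ := X.simplicial.geodesic x y (dist x y * ((k + 1) / (k + 2)))
          ⟨by positivity, mul_le_of_le_one_right dist_nonneg
            ((div_le_one (by positivity)).2 (by linarith))⟩
        have hy : dist x y / (k + 2) < ε := (div_lt_iff₀ (by positivity)).2 (by linarith)
        have e1 : dist x y * ((k + 1) / (k + 2)) = (k + 1) * (dist x y / (k + 2)) := by ring
        refine split x z y (by simp only [Between]; rw [hz1, hz2]; ring) (ih x z ?_) (small z y ?_)
        · rw [hz1, e1]
          exact mul_lt_mul_of_pos_left hy (by positivity)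
        · rw [hz2]
          refine lt_of_le_of_lt (le_of_eq ?_) hy
          field_simp
          ring
  obtain ⟨k, hk⟩ := exists_nat_gt (dist x y / ε)
  exact all k x y (((div_lt_iff₀ hε).1 hk).trans (by linarith))

end MarkedMetricGraph

end OuterSpace

namespace OuterSpace

open Set

/-! ### Stable translation lengths -/

section Stable

variable {G T : Type*} [Group G] [MulAction G T] {D D' : T → T → ℝ} {g : G} {l l' : ℝ}

/-- `D q (g ^ k • q)` grows like `k * l`. -/
def HasStableLength (D : T → T → ℝ) (g : G) (l : ℝ) : Prop :=
  ∀ q, ∃ C, ∀ k : ℕ, |D q (g ^ k • q) - k * l| ≤ C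

theorem IsInvariantPseudoDist.displacement_le (hD : IsInvariantPseudoDist G D) (g : G) (q p : T) :
    D q (g • q) ≤ 2 * D q p + D p (g • p) := by
  have h1 := hD.triangle q p (g • q)
  have h2 := hD.triangle p (g • p) (g • q)
  rw [hD.smul, hD.symm p q] at h2
  linarith

/-- Moving the base point from `q` to `p` changes all displacements by at most `2 * D q p`. -/
theorem IsInvariantPseudoDist.hasStableLength_of_base (hD : IsInvariantPseudoDist G D)
    {q : T} {C : ℝ} (h : ∀ k : ℕ, |D q (g ^ k • q) - k * l| ≤ C) : HasStableLength D g l := by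
  intro p
  refine ⟨C + 2 * D q p, fun k => ?_⟩
  have h1 := hD.displacement_le (g ^ k) q p
  have h2 := hD.displacement_le (g ^ k) p q
  rw [hD.symm p q] at h2
  have h3 := abs_le.1 (h k)
  exact abs_le.2 ⟨by linarith, by linarith⟩

theorem le_of_forall_nat_mul_le {a b C : ℝ} (h : ∀ k : ℕ, k * a ≤ k * b + C) : a ≤ b := by
  by_contra! hlt
  obtain ⟨k, hk⟩ := exists_nat_gt (C / (a - b))
  rw [div_lt_iff₀ (sub_pos.2 hlt)] at hk
  linarith [h k]

theorem HasStableLength.le [Nonempty T] (h : HasStableLength D g l)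
    (h' : HasStableLength D' g l') (hle : ∀ x y, D x y ≤ D' x y) : l ≤ l' := by
  obtain ⟨q⟩ := ‹Nonempty T›
  obtain ⟨C, hC⟩ := h q
  obtain ⟨C', hC'⟩ := h' q
  refine le_of_forall_nat_mul_le (C := C + C') fun k => ?_
  linarith [(abs_le.1 (hC k)).1, (abs_le.1 (hC' k)).2, hle q (g ^ k • q)]

theorem HasStableLength.const_mul (h : HasStableLength D g l) (c : ℝ) :
    HasStableLength (fun x y => c * D x y) g (c * l) := by
  intro q
  obtain ⟨C, hC⟩ := h q
  refine ⟨|c| * C, fun k => ?_⟩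
  rw [show c * D q (g ^ k • q) - k * (c * l) = c * (D q (g ^ k • q) - k * l) by ring, abs_mul]
  exact mul_le_mul_of_nonneg_left (hC k) (abs_nonneg c)

theorem IsInvariantPseudoDist.const_mul (hD : IsInvariantPseudoDist G D) {c : ℝ} (hc : 0 ≤ c) :
    IsInvariantPseudoDist G (fun x y => c * D x y) where
  self x := by simp [hD.self]
  nonneg x y := mul_nonneg hc (hD.nonneg x y)
  symm x y := by rw [hD.symm]
  triangle x y z := by
    rw [← mul_add]
    exact mul_le_mul_of_nonneg_left (hD.triangle x y z) hc
  smul g x y := by rw [hD.smul]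

end Stable

/-! ### Axes and translation lengths. -/

namespace MarkedMetricGraph

variable {n : ℕ} (X : MarkedMetricGraph.{u} n)

instance : Nonempty X.T := X.simplicial.vertex_nonempty.to_type

theorem isInvariantPseudoDist :
    IsInvariantPseudoDist (FreeGroup (Fin n)) (fun x y : X.T => dist x y) :=
  X.simplicial.toIsInvariantPseudoDist

theorem len_le (g : FreeGroup (Fin n)) (p : X.T) : X.len g ≤ dist p (g • p) :=
  ciInf_le ⟨0, forall_mem_range.2 fun _ => dist_nonneg⟩ p

theorem dist_pow_smul_of_axis {g : FreeGroup (Fin n)} {p : X.T} (hp : 0 < dist p (g • p))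
    (h : dist p (g • g • p) = 2 * dist p (g • p)) (k : ℕ) :
    dist p (g ^ k • p) = k * dist p (g • p) := by
  have hstep : ∀ i : ℕ, dist (g ^ i • p) (g ^ (i + 1) • p) = dist p (g • p) := fun i => by
    rw [pow_succ, mul_smul, X.dist_smul]
  have := dist_eq_sum_of_local X.simplicial.hyperbolic (x := fun i : ℕ => g ^ i • p)
    (fun i => by rw [← dist_pos, hstep]; exact hp)
    (fun i => by
      rw [hstep, hstep, pow_add, mul_smul, X.dist_smul, pow_two, mul_smul, h]; ring)
    (Nat.zero_le k)
  simpa [hstep] using this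

/-- On the axis the displacement of `g ^ k` is exactly `k` times that of `g`; at any other `q` it is
at most `k * dist q (g • q)` and differs from the former by a bounded amount. Divide by `k`. -/
theorem len_eq_of_axis {g : FreeGroup (Fin n)} {p : X.T} (hp : 0 < dist p (g • p))
    (h : dist p (g • g • p) = 2 * dist p (g • p)) : X.len g = dist p (g • p) := by
  refine le_antisymm (X.len_le g p) (le_ciInf fun q => ?_)
  refine le_of_forall_nat_mul_le (C := 2 * dist p q) fun k => ?_
  rw [← X.dist_pow_smul_of_axis hp h]
  have hpow : dist q (g ^ k • q) ≤ k * dist q (g • q) := by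
    induction k with
    | zero => simp
    | succ k ih =>
      have h1 := dist_triangle q (g ^ k • q) (g ^ (k + 1) • q)
      rw [pow_succ, mul_smul, X.dist_smul] at h1
      rw [pow_succ, mul_smul]
      push_cast
      linarith
  linarith [X.isInvariantPseudoDist.displacement_le (g ^ k) p q]

/-- An element different from `1` moves some point of the tree along an axis. -/
theorem exists_axis {g : FreeGroup (Fin n)} (hg : g ≠ 1) :
    ∃ p : X.T, 0 < dist p (g • p) ∧ dist p (g • g • p) = 2 * dist p (g • p) := by
  have hyp := X.simplicial.hyperbolic
  obtain ⟨p⟩ : Nonempty X.T := inferInstance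
  set r := dist p (g • p) / 2 with hr
  have hr0 : 0 ≤ r := by positivity
  -- The midpoint of a segment from `p` to `g • p` lies on the axis of `g`. By freeness `m` is
  -- moved.
  obtain ⟨m, hm1, hm2⟩ := X.simplicial.geodesic p (g • p) r
    ⟨hr0, by change r ≤ dist p (g • p); linarith⟩
  replace hm2 : dist m (g • p) = r := by linarith
  have hpg : dist p (g • p) = 2 * r := by linarith
  have hm0 : 0 < dist m (g • m) := by
    rw [dist_pos]
    exact fun h => hg (X.simplicial.free g m (dist_eq_zero.2 h))
  have hg1 : dist (g • p) (g • m) = r := by rw [X.dist_smul, hm1]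
  have hg2 : dist (g • m) (g • g • p) = r := by rw [X.dist_smul, hm2]
  have hgg : dist (g • p) (g • g • p) = 2 * r := by rw [X.dist_smul, hpg]
  have mid : ∀ x, dist m x ≤ max (dist p x) (dist (g • p) x) - r := fun x => by
    have h1 := hyp p (g • p) m x
    rw [hm1, hpg, dist_comm (g • p) m, hm2] at h1
    rcases le_total (dist p x) (dist (g • p) x) with h | h
    · rw [max_eq_right h]
      rcases le_max_iff.1 h1 with h | h <;> linarith
    · rw [max_eq_left h]
      rcases le_max_iff.1 h1 with h | h <;> linarith
  have h1 := mid (g • g • p)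
  have h2 : dist m (g • m) ≤ max (dist m (g • p)) (dist m (g • g • p)) - r := by
    have h3 := hyp (g • p) (g • g • p) (g • m) m
    rw [hgg, hg1, dist_comm (g • g • p) m, dist_comm (g • p) m, dist_comm (g • g • p) (g • m), hg2,
      dist_comm (g • m) m] at h3
    rcases le_total (dist m (g • p)) (dist m (g • g • p)) with h | h
    · rw [max_eq_right h]
      rcases le_max_iff.1 h3 with h | h <;> linarith
    · rw [max_eq_left h]
      rcases le_max_iff.1 h3 with h | h <;> linarith
  have h3 : dist p (g • g • p) = 2 * r + dist m (g • m) := by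
    have t1 := dist_triangle p m (g • g • p)
    have t2 := dist_triangle m (g • m) (g • g • p)
    rw [hgg] at h1
    rcases max_cases (dist p (g • g • p)) (2 * r) with ⟨e1, -⟩ | ⟨e1, -⟩ <;>
    rcases max_cases (dist m (g • p)) (dist m (g • g • p)) with ⟨e2, -⟩ | ⟨e2, -⟩ <;>
    rw [e1] at h1 <;> rw [e2] at h2 <;> linarith
  have h4 : dist p (g • m) = r + dist m (g • m) := by
    have t1 := dist_triangle p m (g • m)
    have t2 := dist_triangle p (g • m) (g • g • p)
    linarith
  refine ⟨m, hm0, ?_⟩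
  -- With `L = dist m (g • m)` this reads `r + 2 * L ≤ max (r + dist m (g • g • m)) (r + L)`, and `L
  -- > 0` excludes the second term.
  have h5 := hyp (g • p) (g • g • m) (g • m) m
  have h6 : dist (g • p) (g • g • m) = r + dist m (g • m) := by rw [X.dist_smul, h4]
  have h7 : dist (g • m) (g • g • m) = dist m (g • m) := X.dist_smul g _ _
  have h8 := dist_triangle m (g • m) (g • g • m)
  rw [h6, hg1, dist_comm (g • p) m, hm2, dist_comm (g • g • m) m, dist_comm (g • g • m) (g • m), h7,
    dist_comm (g • m) m] at h5
  rcases le_max_iff.1 h5 with h | h <;> linarith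

theorem len_pos {g : FreeGroup (Fin n)} (hg : g ≠ 1) : 0 < X.len g := by
  obtain ⟨p, hp, h⟩ := X.exists_axis hg
  rwa [X.len_eq_of_axis hp h]

theorem hasStableLength {g : FreeGroup (Fin n)} (hg : g ≠ 1) :
    HasStableLength (fun x y : X.T => dist x y) g (X.len g) := by
  obtain ⟨p, hp, h⟩ := X.exists_axis hg
  refine X.isInvariantPseudoDist.hasStableLength_of_base (q := p) (C := 0) fun k => ?_
  rw [X.len_eq_of_axis hp h, X.dist_pow_smul_of_axis hp h]
  simp

end MarkedMetricGraph

/-- The map `h` is equivariant up to `D`-distance zero, so orbits in `X` and in its image grow at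
proportional rates. -/
theorem Represents.exists_hasStableLength {n : ℕ} {X : MarkedMetricGraph.{u} n} {T : Type u}
    [MulAction (FreeGroup (Fin n)) T] {D : T → T → ℝ} (h : Represents X D)
    (hD : IsInvariantPseudoDist (FreeGroup (Fin n)) D) :
    ∃ c : ℝ, 0 < c ∧ ∀ g : FreeGroup (Fin n), g ≠ 1 → HasStableLength D g (c * X.len g) := by
  obtain ⟨c, hc, h, hdist, hequi⟩ := h
  refine ⟨c, hc, fun g hg => ?_⟩
  obtain ⟨p⟩ : Nonempty X.T := inferInstance
  obtain ⟨C, hC⟩ := (X.hasStableLength hg).const_mul c p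
  refine hD.hasStableLength_of_base (q := h p) (C := C) fun k => ?_
  have h1 : D (h p) (g ^ k • h p) = c * dist p (g ^ k • p) := by
    rw [← hdist]
    have t1 := hD.triangle (h p) (h (g ^ k • p)) (g ^ k • h p)
    have t2 := hD.triangle (h p) (g ^ k • h p) (h (g ^ k • p))
    rw [hequi] at t1
    rw [hD.symm (g ^ k • h p), hequi] at t2
    linarith
  rw [h1]
  exact hC k

/-! ### Legal loops of an optimal map -/

section Legal

variable {n : ℕ} {A B : MarkedMetricGraph.{u} n} {f : A.T → B.T}

theorem speed_swap (f : A.T → B.T) (a b : A.T) : speed f b a = speed f a b := by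
  simp only [speed, dist_comm]

theorem IsMaxEdge.swap {a b : A.T} (h : IsMaxEdge f a b) : IsMaxEdge f b a :=
  ⟨h.1.swap, by rw [speed_swap, h.2]⟩

theorem IsMaxEdge.dist_eq {a b : A.T} (h : IsMaxEdge f a b) :
    dist (f a) (f b) = maxSpeed f * dist a b := by
  rw [← h.2, speed, div_mul_cancel₀]
  exact (dist_pos.2 h.1.ne).ne'

theorem maxSpeed_nonneg (f : A.T → B.T) : 0 ≤ maxSpeed f := by
  refine Real.sSup_nonneg ?_
  rintro _ ⟨a, b, -, rfl⟩
  exact div_nonneg dist_nonneg dist_nonneg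

/-- The speed is constant on orbits of edges, so the supremum is over a finite set. -/
theorem exists_isMaxEdge (hf : IsPL f) : ∃ a b, IsMaxEdge f a b := by
  obtain ⟨F, hF, h⟩ := A.simplicial.edge_finite
  have hfin : {r | ∃ a b, A.Edge a b ∧ r = speed f a b}.Finite := by
    refine (hF.image fun e => speed f e.1 e.2).subset ?_
    rintro _ ⟨a, b, hab, rfl⟩
    obtain ⟨g, e, he, h1, h2⟩ := h a b hab
    simp only [dist_eq_zero] at h1 h2
    refine ⟨e, he, ?_⟩
    simp only [speed, ← h1, ← h2, hf.1, A.dist_smul, B.dist_smul]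
  obtain ⟨p⟩ : Nonempty A.T := inferInstance
  obtain ⟨a, b, hab, -⟩ := A.simplicial.edge_cover p
  have hne : {r | ∃ a b, A.Edge a b ∧ r = speed f a b}.Nonempty := ⟨_, a, b, hab, rfl⟩
  obtain ⟨a, b, hab, h⟩ := hne.csSup_mem hfin
  exact ⟨a, b, hab, h.symm⟩

theorem MarkedMetricGraph.finite_edges_at (v : A.T) : {a | A.Edge v a}.Finite := by
  obtain ⟨F, hF, h⟩ := A.simplicial.edge_finite
  choose! g e he h1 h2 using fun a => h v a
  refine Set.Finite.of_finite_image (f := e) (hF.subset ?_) ?_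
  · rintro _ ⟨a, ha, rfl⟩
    exact he a ha
  · intro a ha b hb hab
    have ha1 := h1 a ha
    have ha2 := h2 a ha
    have hb1 := h1 b hb
    have hb2 := h2 b hb
    simp only [dist_eq_zero] at ha1 ha2 hb1 hb2
    have hg : (g b)⁻¹ * g a = 1 := A.simplicial.free _ v (by
      simp [mul_smul, ha1, hab, ← hb1])
    have hg' : g a = g b := (inv_mul_eq_one.1 hg).symm
    rw [← hab, ← ha2, hg'] at hb2
    exact (smul_left_cancel _ hb2).symm

/-- For an optimal map, a maximally stretched edge continues to a legal path of length two. -/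
theorem IsOptimal.exists_legal_turn (hf : IsOptimal f) {v u : A.T}
    (hvu : IsMaxEdge f v u) :
    ∃ a, IsMaxEdge f u a ∧ dist (f v) (f u) + dist (f u) (f a) = dist (f v) (f a) := by
  by_contra! hcon
  refine hf.2 ⟨u, ⟨v, hvu.swap⟩, ?_⟩
  -- The Gromov product at `f u`: the length of the common initial segment of the images of `[u, v]`
  -- and `[u, a]`. If no turn is legal, it is positive on all maximal edges at `u`.
  set P : A.T → ℝ := fun a => (dist (f v) (f u) + dist (f u) (f a) - dist (f v) (f a)) / 2 with hP
  have hfin : {a | IsMaxEdge f u a}.Finite := (A.finite_edges_at u).subset fun a ha => ha.1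
  obtain ⟨a₀, ha₀, hmin⟩ := Set.exists_min_image _ P hfin ⟨v, hvu.swap⟩
  have hpos : 0 < P a₀ := by
    have h1 := hcon a₀ ha₀
    have h2 := dist_triangle (f v) (f u) (f a₀)
    have h3 := lt_of_le_of_ne h2 h1.symm
    simp only [hP]
    linarith
  have hPv : P v = dist (f u) (f v) := by simp [hP, dist_comm]
  -- The minimal overlap is shared by the images of all maximal edges at `u`, against optimality.
  obtain ⟨y, hy1, hy2⟩ := B.simplicial.geodesic (f u) (f v) (P a₀)
    ⟨hpos.le, (hmin v hvu.swap).trans_eq hPv⟩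
  refine ⟨y, fun h => ?_, fun a ha => ?_⟩
  · rw [h, dist_self] at hy1
    exact hpos.ne hy1
  · have h1 := B.simplicial.hyperbolic y (f a) (f u) (f v)
    have h2 := hmin a ha
    have h3 := dist_triangle (f u) y (f a)
    simp only [hP] at h1 h2
    simp only [hP] at hy1 hy2
    simp only [Between]
    rw [dist_comm y (f u), hy1, hy2, dist_comm (f a) (f v), dist_comm (f a) (f u)] at h1
    rw [hy1] at h3 ⊢
    rw [dist_comm (f v) (f u)] at *
    rcases le_max_iff.1 h1 with h | h <;> linarith

/-- An optimal map stretches the loop of some element by the factor `S_f`. -/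
theorem IsOptimal.exists_maxSpeed_mul_len_le (hf : IsOptimal f) (hS : 0 < maxSpeed f) :
    ∃ g : FreeGroup (Fin n), g ≠ 1 ∧ maxSpeed f * A.len g ≤ B.len g := by
  obtain ⟨a, b, hab⟩ := exists_isMaxEdge hf.1
  choose! nxt hnxt using fun (e : A.T × A.T) (he : IsMaxEdge f e.1 e.2) => hf.exists_legal_turn he
  set e : ℕ → A.T × A.T := fun k => (fun e => (e.2, nxt e))^[k] (a, b) with he
  have hsucc : ∀ k, e (k + 1) = ((e k).2, nxt (e k)) := fun k => Function.iterate_succ_apply' _ _ _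
  have hmax : ∀ k, IsMaxEdge f (e k).1 (e k).2 := by
    intro k
    induction k with
    | zero => exact hab
    | succ k ih => rw [hsucc]; exact (hnxt _ ih).1
  have h2 : ∀ k, (e k).2 = (e (k + 1)).1 := fun k => by rw [hsucc]
  have hlen : ∀ k, dist (f (e k).1) (f (e (k + 1)).1) =
      maxSpeed f * dist (e k).1 (e (k + 1)).1 := fun k => by
    rw [← h2, (hmax k).dist_eq]
  have hne : ∀ k, f (e k).1 ≠ f (e (k + 1)).1 := fun k => by
    rw [← dist_pos, hlen, ← h2]
    exact mul_pos hS (dist_pos.2 (hmax k).1.ne)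
  have hloc : ∀ k, dist (f (e k).1) (f (e (k + 1)).1) + dist (f (e (k + 1)).1) (f (e (k + 2)).1) =
      dist (f (e k).1) (f (e (k + 2)).1) := fun k => by
    have h3 := (hnxt _ (hmax k)).2
    have h4 : (e (k + 2)).1 = nxt (e k) := by rw [← h2, hsucc]
    rwa [h4, ← h2]
  have hsum := fun {i j : ℕ} (hij : i ≤ j) =>
    dist_eq_sum_of_local B.simplicial.hyperbolic (x := fun k => f (e k).1) hne hloc hij
  have hadd : ∀ {i j k : ℕ}, i ≤ j → j ≤ k → dist (f (e i).1) (f (e j).1) +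
      dist (f (e j).1) (f (e k).1) = dist (f (e i).1) (f (e k).1) := fun hij hjk => by
    rw [hsum hij, hsum hjk, hsum (hij.trans hjk), Finset.sum_Ico_consecutive _ hij hjk]
  obtain ⟨F, hF, h⟩ := A.simplicial.edge_finite
  choose g E hE hg1 hg2 using fun k => h _ _ (hmax k).1
  simp only [dist_eq_zero] at hg1 hg2
  have : Finite F := hF.to_subtype
  -- Pigeonhole on orbits of oriented edges: some `w` takes the `i`-th edge of the legal path to the
  -- `j`-th, so the closed-up loop is legal at its closing point too.
  obtain ⟨i, j, hij, hEij⟩ : ∃ i j, i < j ∧ E i = E j := by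
    obtain ⟨i, j, hij, h⟩ := Finite.exists_ne_map_eq_of_infinite fun k => (⟨E k, hE k⟩ : F)
    rw [Subtype.mk.injEq] at h
    rcases hij.lt_or_gt with h' | h'
    exacts [⟨i, j, h', h⟩, ⟨j, i, h', h.symm⟩]
  set w := (g j)⁻¹ * g i with hw
  have hw1 : (e j).1 = w • (e i).1 := by
    rw [hw, mul_smul, hg1, hEij, ← hg1 j, inv_smul_smul]
  have hw2 : (e (j + 1)).1 = w • (e (i + 1)).1 := by
    rw [← h2, ← h2, hw, mul_smul, hg2, hEij, ← hg2 j, inv_smul_smul]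
  have hfw1 : f (e j).1 = w • f (e i).1 := by rw [hw1, hf.1.1]
  have hfw2 : f (e (j + 1)).1 = w • f (e (i + 1)).1 := by rw [hw2, hf.1.1]
  have hpos : 0 < dist (f (e i).1) (w • f (e i).1) := by
    rw [← hfw1, ← hadd i.le_succ hij]
    exact add_pos_of_pos_of_nonneg (dist_pos.2 (hne i)) dist_nonneg
  -- The image path and its translate by `w` overlap in the image of the `j`-th edge, so their union
  -- is geodesic.
  have haxis : dist (f (e i).1) (w • w • f (e i).1) = 2 * dist (f (e i).1) (w • f (e i).1) := by
    have t1 := hadd hij.le j.le_succ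
    have t2 := hadd i.le_succ hij
    rw [← B.dist_smul w, ← B.dist_smul w (f (e (i + 1)).1), ← B.dist_smul w (f (e i).1)] at t2
    rw [Nat.succ_eq_add_one] at t1 t2
    rw [← hfw2, ← hfw1] at t2
    have t3 := dist_eq_add_of_overlap B.simplicial.hyperbolic t1 t2 (hne j)
    have t4 : dist (f (e j).1) (w • f (e j).1) = dist (f (e i).1) (w • f (e i).1) := by
      rw [hfw1, B.dist_smul]
    rw [hfw1] at t1 t2 t3 t4
    linarith
  refine ⟨w, ?_, ?_⟩
  · intro h1
    rw [h1, one_smul, dist_self] at hpos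
    exact hpos.false
  · rw [B.len_eq_of_axis hpos haxis, ← hfw1, hsum hij.le]
    simp only [hlen]
    rw [← Finset.mul_sum]
    refine mul_le_mul_of_nonneg_left ((A.len_le w (e i).1).trans ?_) hS.le
    rw [← hw1]
    exact dist_le_Ico_sum_dist (fun k => (e k).1) hij.le

end Legal

end OuterSpace

namespace OuterSpace

open Set

/-! ### Quotient distances -/

section Quotient

variable {G T S : Type*} [Group G] [MulAction G T] {D : T → T → ℝ} {R R' : T → T → Prop}

theorem Chain.nonneg (hD : IsInvariantPseudoDist G D) {x y : T} {r : ℝ} (h : Chain D R x y r) :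
    0 ≤ r := by
  induction h with
  | move => exact hD.nonneg _ _
  | jump w _ _ ih => exact add_nonneg ih (hD.nonneg _ _)

theorem Chain.mono (hR : ∀ x y, R x y → R' x y) {x y : T} {r : ℝ} (h : Chain D R x y r) :
    Chain D R' x y r := by
  induction h with
  | move => exact .move _ _
  | jump w _ hR' ih => exact .jump w ih (hR _ _ hR')

theorem Chain.exists_move (hD : IsInvariantPseudoDist G D) {x y : T} {r : ℝ}
    (h : Chain D R x y r) (z : T) : ∃ s ≤ r + D y z, Chain D R x z s := by
  cases h with
  | move => exact ⟨_, hD.triangle _ _ _, .move _ _⟩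
  | @jump _ y' r' _ h hR =>
    exact ⟨_, by linarith [hD.triangle y' y z], .jump z h hR⟩

theorem Chain.exists_trans (hD : IsInvariantPseudoDist G D) {x y z : T} {r s : ℝ}
    (h : Chain D R x y r) (h' : Chain D R y z s) : ∃ t ≤ r + s, Chain D R x z t := by
  induction h' with
  | move => exact h.exists_move hD _
  | jump w _ hR ih =>
    obtain ⟨t, ht, h'⟩ := ih
    exact ⟨_, by linarith, .jump w h' hR⟩

theorem Chain.exists_symm (hD : IsInvariantPseudoDist G D) (hR : ∀ x y, R x y → R y x) {x y : T}
    {r : ℝ} (h : Chain D R x y r) : ∃ s ≤ r, Chain D R y x s := by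
  induction h with
  | move => exact ⟨_, (hD.symm _ _).le, .move _ _⟩
  | @jump y z r w _ hyz ih =>
    obtain ⟨s, hs, h⟩ := ih
    obtain ⟨t, ht, h'⟩ := (Chain.jump y (.move w z) (hR _ _ hyz)).exists_trans hD h
    rw [hD.self, hD.symm w z] at ht
    exact ⟨t, by linarith, h'⟩

theorem Chain.smul (hD : IsInvariantPseudoDist G D) (g : G)
    (hR : ∀ x y, R x y → R (g • x) (g • y)) {x y : T} {r : ℝ}
    (h : Chain D R x y r) : Chain D R (g • x) (g • y) r := by
  induction h with
  | move y => exact hD.smul g x y ▸ .move _ _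
  | @jump y z r w _ hyz ih => exact hD.smul g z w ▸ .jump (g • w) ih (hR _ _ hyz)

theorem bddBelow_chain (hD : IsInvariantPseudoDist G D) (x y : T) :
    BddBelow {r | Chain D R x y r} :=
  ⟨0, fun _ h => Chain.nonneg hD h⟩

theorem nonempty_chain (x y : T) : {r | Chain D R x y r}.Nonempty := ⟨_, .move x y⟩

theorem quotDist_le_of_chain (hD : IsInvariantPseudoDist G D) {x y : T} {r : ℝ}
    (h : ∃ s ≤ r, Chain D R x y s) : quotDist D R x y ≤ r := by
  obtain ⟨s, hs, h⟩ := h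
  exact (csInf_le (bddBelow_chain hD x y) h).trans hs

theorem isInvariantPseudoDist_quotDist (hD : IsInvariantPseudoDist G D)
    (hsymm : ∀ x y, R x y → R y x) (hsmul : ∀ (g : G) x y, R x y → R (g • x) (g • y)) :
    IsInvariantPseudoDist G (quotDist D R) := by
  have symm_le : ∀ x y, quotDist D R x y ≤ quotDist D R y x := fun x y =>
    le_csInf (nonempty_chain y x) fun r h => quotDist_le_of_chain hD (h.exists_symm hD hsymm)
  have smul_le : ∀ (g : G) x y, quotDist D R (g • x) (g • y) ≤ quotDist D R x y := fun g x y =>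
    le_csInf (nonempty_chain x y) fun r h =>
      quotDist_le_of_chain hD ⟨r, le_rfl, h.smul hD g (hsmul g)⟩
  have nonneg : ∀ x y, 0 ≤ quotDist D R x y := fun x y =>
    le_csInf (nonempty_chain x y) fun r h => h.nonneg hD
  refine ⟨fun x => ?_, nonneg, fun x y => (symm_le x y).antisymm (symm_le y x), fun x y z => ?_,
    fun g x y => (smul_le g x y).antisymm ?_⟩
  · exact (quotDist_le_of_chain hD ⟨_, (hD.self x).le, .move x x⟩).antisymm (nonneg x x)
  · rw [← sub_le_iff_le_add]
    refine le_csInf (nonempty_chain x y) fun r h => ?_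
    rw [sub_le_comm]
    refine le_csInf (nonempty_chain y z) fun s h' => ?_
    rw [sub_le_iff_le_add']
    exact quotDist_le_of_chain hD (h.exists_trans hD h')
  · simpa using smul_le g⁻¹ (g • x) (g • y)

theorem quotDist_anti (hD : IsInvariantPseudoDist G D) (hR : ∀ x y, R x y → R' x y) (x y : T) :
    quotDist D R' x y ≤ quotDist D R x y :=
  csInf_le_csInf (bddBelow_chain hD x y) (nonempty_chain x y) fun _ h => Chain.mono hR h

theorem foldDist_anti (hD : IsInvariantPseudoDist G D) {f : T → S} {U : Set T} (x y : T) :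
    Antitone fun t => foldDist f D U t x y := fun _ _ hst =>
  quotDist_anti hD (fun _ _ ⟨v, hv, h, h1, h2⟩ => ⟨v, hv, h, h1.trans hst, h2.trans hst⟩) x y

theorem isInvariantPseudoDist_foldDist [MulAction G S] (hD : IsInvariantPseudoDist G D)
    {f : T → S} (hf : ∀ (g : G) x, f (g • x) = g • f x) {U : Set T}
    (hU : ∀ (g : G), ∀ v ∈ U, g • v ∈ U) (t : ℝ) :
    IsInvariantPseudoDist G (foldDist f D U t) := by
  refine isInvariantPseudoDist_quotDist hD ?_ ?_
  · rintro x y ⟨v, hv, h, h1, h2⟩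
    exact ⟨v, hv, h.symm, h2, h1⟩
  · rintro g x y ⟨v, hv, h, h1, h2⟩
    exact ⟨g • v, hU g v hv, by rw [hf, hf, h], by rwa [hD.smul], by rwa [hD.smul]⟩

end Quotient

/-! ### The distances along a path -/

namespace ShrinkFoldPath

variable {n : ℕ} {A B : MarkedMetricGraph.{u} n} (P : ShrinkFoldPath A B)

/-- Only the lengths of edges are assumed to decrease; additivity of the larger distance along
segments extends this to all pairs. -/
theorem D_antitoneOn (x y : A.T) : AntitoneOn (fun p => P.D p x y) (Icc 0 1) := by
  intro p hp q hq hpq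
  have hDp := P.shrinking.rescaling p hp
  have hDq := P.shrinking.rescaling q hq
  refine A.le_of_le_on_edges hDq.triangle hDp.additive ?_ x y
  rintro x y ⟨a, b, hab, hx, hy⟩
  rw [hDq.linear a b hab x y hx hy, hDp.linear a b hab x y hx hy]
  exact mul_le_mul_of_nonneg_right (div_le_div_of_nonneg_right
    (P.shrinking.antitone a b hab hp hq hpq) dist_nonneg) dist_nonneg

theorem τ_le_succ {i : ℕ} (hi : i < P.N) : P.τ i ≤ P.τ (i + 1) :=
  sub_nonneg.1 (P.step i hi).1.1

theorem τ_nonneg {i : ℕ} (hi : i ≤ P.N) : 0 ≤ P.τ i := by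
  induction i with
  | zero => exact P.τ_zero.ge
  | succ i ih => exact (ih (by omega)).trans (P.τ_le_succ hi)

/-- Within a step, a longer folding time identifies more points and allows more chains; consecutive
steps are glued at their common time. -/
theorem E_antitoneOn {i : ℕ} (hi : i ≤ P.N) (x y : A.T) :
    AntitoneOn (fun t => P.E t x y) (Icc 0 (P.τ i)) := by
  induction i with
  | zero => simp [P.τ_zero]
  | succ i ih =>
    have hstep := P.τ_le_succ hi
    have h0 := P.τ_nonneg (i := i) (by omega)
    rw [← Icc_union_Icc_eq_Icc h0 hstep]
    refine (ih (by omega)).union_right ?_ (isGreatest_Icc h0) (isLeast_Icc hstep)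
    intro s hs t ht hst
    simp only [P.folding i hi s hs, P.folding i hi t ht]
    exact foldDist_anti (P.subdivision_source i hi).toIsInvariantPseudoDist x y (by linarith)

theorem isInvariantPseudoDist_E {i : ℕ} (hi : i ≤ P.N) {t : ℝ} (ht : t ∈ Icc 0 (P.τ i)) :
    IsInvariantPseudoDist (FreeGroup (Fin n)) (P.E t) := by
  induction i with
  | zero =>
    rw [P.τ_zero, Icc_self, mem_singleton_iff] at ht
    have h0 : P.E t = fun x y => maxSpeed P.f * P.D 1 x y := by
      ext x y
      rw [ht, P.E_zero]
    rw [h0]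
    exact (P.shrinking.rescaling 1 (by simp)).toIsInvariantPseudoDist.const_mul
      (maxSpeed_nonneg _)
  | succ i ih =>
    rcases le_total t (P.τ i) with h | h
    · exact ih (by omega) ⟨ht.1, h⟩
    · have hT := P.subdivision_source i hi
      rw [P.folding i hi t ⟨h, ht.2⟩]
      exact isInvariantPseudoDist_foldDist hT.toIsInvariantPseudoDist P.optimal.1.1
        hT.vertex_smul _

/-- The distance at the time `p`, scaled so that `f` does not increase lengths. -/
noncomputable def scaledDist (p : ℝ) (x y : A.T) : ℝ :=
  (if p < 0 then maxSpeed P.f else 1) * P.distAt p x y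

theorem scaledDist_of_neg {p : ℝ} (hp : p < 0) (x y : A.T) :
    P.scaledDist p x y = maxSpeed P.f * P.D (p + 1) x y := by
  simp [scaledDist, distAt, hp]

theorem scaledDist_of_nonneg {p : ℝ} (hp : 0 ≤ p) (x y : A.T) :
    P.scaledDist p x y = P.E p x y := by
  simp [scaledDist, distAt, hp.not_gt]

theorem scaledDist_neg_one (x y : A.T) : P.scaledDist (-1) x y = maxSpeed P.f * dist x y := by
  rw [P.scaledDist_of_neg (by norm_num), neg_add_cancel, P.shrinking.start]

theorem scaledDist_τ (x y : A.T) : P.scaledDist (P.τ P.N) x y = dist (P.f x) (P.f y) := by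
  rw [P.scaledDist_of_nonneg (P.τ_nonneg le_rfl), P.finish]

theorem isInvariantPseudoDist_distAt {p : ℝ} (hp : p ∈ Icc (-1) (P.τ P.N)) :
    IsInvariantPseudoDist (FreeGroup (Fin n)) (P.distAt p) := by
  by_cases h : p < 0
  · simp only [distAt, h, if_true]
    exact (P.shrinking.rescaling (p + 1)
      ⟨by linarith [hp.1], by linarith⟩).toIsInvariantPseudoDist
  · simp only [distAt, h, if_false]
    exact P.isInvariantPseudoDist_E le_rfl ⟨not_lt.1 h, hp.2⟩

/-- The shrinking and folding parts fit together at time `0` because `E_zero` contains the factor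
`maxSpeed f`. -/
theorem scaledDist_antitoneOn (x y : A.T) :
    AntitoneOn (fun p => P.scaledDist p x y) (Icc (-1) (P.τ P.N)) := by
  have hneg : ∀ p ∈ Icc (-1 : ℝ) 0, P.scaledDist p x y = maxSpeed P.f * P.D (p + 1) x y := by
    intro p hp
    rcases hp.2.lt_or_eq with h | rfl
    · exact P.scaledDist_of_neg h x y
    · rw [P.scaledDist_of_nonneg le_rfl, P.E_zero, zero_add]
  have h0 := P.τ_nonneg le_rfl
  rw [← Icc_union_Icc_eq_Icc (by norm_num : (-1 : ℝ) ≤ 0) h0]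
  refine AntitoneOn.union_right ?_ ?_ (isGreatest_Icc (by norm_num)) (isLeast_Icc h0)
  · intro p hp q hq hpq
    simp only [hneg p hp, hneg q hq]
    exact mul_le_mul_of_nonneg_left (P.D_antitoneOn x y ⟨by linarith [hp.1], by linarith [hp.2]⟩
      ⟨by linarith [hq.1], by linarith [hq.2]⟩ (by linarith)) (maxSpeed_nonneg _)
  · intro p hp q hq hpq
    simp only [P.scaledDist_of_nonneg hp.1, P.scaledDist_of_nonneg hq.1]
    exact P.E_antitoneOn le_rfl x y hp hq hpq

/-- With speed zero the scaled distance vanishes from the start, so `g` would fix `P.f x`, against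
freeness. -/
theorem maxSpeed_pos [Nontrivial (FreeGroup (Fin n))] : 0 < maxSpeed P.f := by
  refine (maxSpeed_nonneg _).lt_of_ne fun h => ?_
  obtain ⟨g, hg⟩ := exists_ne (1 : FreeGroup (Fin n))
  obtain ⟨x⟩ : Nonempty A.T := inferInstance
  refine hg (B.simplicial.free g (P.f x) ?_)
  have hanti := P.scaledDist_antitoneOn x (g • x) (left_mem_Icc.2 ?_) (right_mem_Icc.2 ?_) ?_
  · simp only [P.scaledDist_neg_one, P.scaledDist_τ, ← h, zero_mul] at hanti
    rw [← P.optimal.1.1]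
    exact hanti.antisymm dist_nonneg
  all_goals linarith [P.τ_nonneg le_rfl]

/-- The translation lengths along a path, suitably scaled, decrease, and one of them is
constant. -/
theorem exists_scale [Nontrivial (FreeGroup (Fin n))] {X : ℝ → MarkedMetricGraph.{u} n}
    (hX : ∀ p ∈ Icc (-1) (P.τ P.N), Represents (X p) (P.distAt p)) :
    ∃ c : ℝ → ℝ, (∀ p ∈ Icc (-1) (P.τ P.N), 0 < c p) ∧
      (∀ g : FreeGroup (Fin n), g ≠ 1 →
        AntitoneOn (fun p => c p * (X p).len g) (Icc (-1) (P.τ P.N))) ∧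
      ∃ g : FreeGroup (Fin n), g ≠ 1 ∧ ∃ l, ∀ p ∈ Icc (-1) (P.τ P.N), c p * (X p).len g = l := by
  have hS := P.maxSpeed_pos
  have hstable : ∀ p ∈ Icc (-1) (P.τ P.N), ∃ c : ℝ, 0 < c ∧ ∀ g : FreeGroup (Fin n), g ≠ 1 →
      HasStableLength (P.scaledDist p) g (c * (X p).len g) := by
    intro p hp
    obtain ⟨c, hc, h⟩ := (hX p hp).exists_hasStableLength (P.isInvariantPseudoDist_distAt hp)
    refine ⟨(if p < 0 then maxSpeed P.f else 1) * c, ?_, fun g hg => ?_⟩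
    · split_ifs <;> positivity
    · rw [mul_assoc]
      exact (h g hg).const_mul _
  choose! c hc hlen using hstable
  have hτ : (-1 : ℝ) ≤ P.τ P.N := by linarith [P.τ_nonneg le_rfl]
  refine ⟨c, hc, fun g hg p hp q hq hpq => ?_, ?_⟩
  · exact (hlen q hq g hg).le (hlen p hp g hg) fun x y => P.scaledDist_antitoneOn x y hp hq hpq
  · obtain ⟨g, hg, hle⟩ := P.optimal.exists_maxSpeed_mul_len_le hS
    refine ⟨g, hg, B.len g, fun p hp => le_antisymm (le_trans ?_ hle) ?_⟩
    · refine (hlen p hp g hg).le ((A.hasStableLength hg).const_mul (maxSpeed P.f)) fun x y => ?_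
      rw [← P.scaledDist_neg_one]
      exact P.scaledDist_antitoneOn x y (left_mem_Icc.2 hτ) hp hp.1
    · have hB : HasStableLength (fun x y => dist (P.f x) (P.f y)) g (B.len g) := fun q => by
        simp only [P.optimal.1.1]
        exact B.hasStableLength hg (P.f q)
      refine hB.le (hlen p hp g hg) fun x y => ?_
      rw [← P.scaledDist_τ]
      exact P.scaledDist_antitoneOn x y hp (right_mem_Icc.2 hτ) hp.2

end ShrinkFoldPath

/-- If the translation lengths decrease, and one of them is constant, the right hand factor is
determined by the scales, and the product of both factors is a supremum of scaled ratios. -/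
theorem stretchR_mul_stretchL {n : ℕ} {X Y : MarkedMetricGraph.{u} n} {c d : ℝ} (hc : 0 < c)
    (hd : 0 < d) (h : ∀ g : FreeGroup (Fin n), g ≠ 1 → d * Y.len g ≤ c * X.len g)
    (h' : ∃ g : FreeGroup (Fin n), g ≠ 1 ∧ d * Y.len g = c * X.len g) :
    stretchR X Y * stretchL X Y =
      ⨆ (g : FreeGroup (Fin n)) (_ : g ≠ 1), ENNReal.ofReal (c * X.len g / (d * Y.len g)) := by
  have hR : stretchR X Y = ENNReal.ofReal (c / d) := by
    refine le_antisymm (iSup₂_le fun g hg => ENNReal.ofReal_le_ofReal ?_) ?_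
    · rw [div_le_div_iff₀ (X.len_pos hg) hd]
      linarith [h g hg]
    · obtain ⟨g, hg, hgl⟩ := h'
      refine le_iSup₂_of_le g hg (ENNReal.ofReal_le_ofReal ?_)
      rw [div_le_div_iff₀ hd (X.len_pos hg)]
      linarith
  rw [hR, stretchL]
  simp only [ENNReal.mul_iSup]
  refine iSup_congr fun g => iSup_congr fun _ => ?_
  rw [← ENNReal.ofReal_mul (by positivity), div_mul_div_comm]

end OuterSpace

theorem mainTheorem9 (n : ℕ) (A B : OuterSpace.MarkedMetricGraph.{u} n)
    (α : ℝ → OuterSpace.MarkedMetricGraph.{u} n) (a b : ℝ)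
    (hα : OuterSpace.IsShrinkFoldGeodesic A B α a b)
    (s x y t : ℝ) (has : a ≤ s) (hsx : s ≤ x) (hxy : x ≤ y) (hyt : y ≤ t) (htb : t ≤ b) :
    OuterSpace.symDist (α s) (α t) ≥ OuterSpace.symDist (α x) (α y) := by
  open OuterSpace Set in
  refine ENNReal.log_le_log ?_
  -- For the trivial group the suprema are empty, so the smaller product is `0`.
  rcases subsingleton_or_nontrivial (FreeGroup (Fin n)) with hG | hG
  · have h0 : stretchR (α x) (α y) = 0 := by
      simp [stretchR, Subsingleton.elim _ (1 : FreeGroup (Fin n))]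
    rw [h0, zero_mul]
    exact zero_le
  obtain ⟨P, φ, hφ, himg, hrep⟩ := hα
  obtain ⟨c, hc, hanti, g₀, hg₀, l, hl⟩ := P.exists_scale hrep
  have hpre : ∀ r ∈ Icc a b, ∃ p ∈ Icc (-1) (P.τ P.N), φ p = r := fun r hr => by
    rwa [← himg] at hr
  -- A section of the parametrisation. It is monotone: a reversal `ψ r' < ψ r` with `r ≤ r'` would
  -- force `r = r'`.
  choose! ψ hψ hφψ using hpre
  have hψmono : MonotoneOn ψ (Icc a b) := by
    intro r hr r' hr' hrr
    by_contra! hlt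
    have h := hφ (hψ r' hr') (hψ r hr) hlt.le
    rw [hφψ r hr, hφψ r' hr'] at h
    exact hlt.ne (by rw [le_antisymm hrr h])
  have hs : s ∈ Icc a b := ⟨has, by linarith⟩
  have hx : x ∈ Icc a b := ⟨by linarith, by linarith⟩
  have hy : y ∈ Icc a b := ⟨by linarith, by linarith⟩
  have ht : t ∈ Icc a b := ⟨by linarith, htb⟩
  have hmono : ∀ r ∈ Icc a b, ∀ r' ∈ Icc a b, r ≤ r' → ∀ g : FreeGroup (Fin n), g ≠ 1 →
      c (ψ r') * (α r').len g ≤ c (ψ r) * (α r).len g := by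
    intro r hr r' hr' hrr g hg
    have := hanti g hg (hψ r hr) (hψ r' hr') (hψmono hr hr' hrr)
    simpa only [hφψ r hr, hφψ r' hr'] using this
  have hprod : ∀ r ∈ Icc a b, ∀ r' ∈ Icc a b, r ≤ r' →
      stretchR (α r) (α r') * stretchL (α r) (α r') = ⨆ (g : FreeGroup (Fin n)) (_ : g ≠ 1),
        ENNReal.ofReal (c (ψ r) * (α r).len g / (c (ψ r') * (α r').len g)) := by
    intro r hr r' hr' hrr
    refine stretchR_mul_stretchL (hc _ (hψ r hr)) (hc _ (hψ r' hr')) (hmono r hr r' hr' hrr)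
      ⟨g₀, hg₀, ?_⟩
    have h1 := hl _ (hψ r hr)
    have h2 := hl _ (hψ r' hr')
    rw [hφψ r hr] at h1
    rw [hφψ r' hr'] at h2
    rw [h1, h2]
  rw [hprod x hx y hy hxy, hprod s hs t ht (by linarith)]
  refine iSup₂_mono fun g hg => ENNReal.ofReal_le_ofReal ?_
  exact div_le_div₀ (mul_nonneg (hc _ (hψ s hs)).le ((α s).len_pos hg).le)
    (hmono s hs x hx hsx g hg) (mul_pos (hc _ (hψ t ht)) ((α t).len_pos hg))
    (hmono y hy t ht hyt g hg)
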